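/- Let $H^2=H^2(\mathbb D)$ be the Hardy space of the unit disc, i.e. the holomorphic functions $f(z)=\sum_k a_kz^k$ on $\mathbb D$ with $\|f\|^2=\sum_k|a_k|^2<\infty$. For a bounded operator $T$ on $H^2$ and $n\ge 1$ let $a_n(T)=\inf\{\|T-R\| : \operatorname{rank}R<n\}$. For a finite set $W\subset\mathbb D$ let $M(W)$ be its constant of interpolation, the smallest $C$ such that for all complex numbers $(a_w)_{w\in W}$ there is $f\in H^2$ with $f(w)=a_w$ for all $w\in W$ and $\|f\|\le C\big(\sum_{w\in W}|a_w|^2(1-|w|^2)\big)^{1/2}$. For $Z=\{z_1,\dots,z_n\}\subset\mathbb D$ let $\nu_Z=\sum_j(1-|z_j|^2)\delta_{z_j}$. Let $\|\nu_Z\|_{\mathcal C}$ be its Carleson norm with respect to $H^2$, the smallest $C$ with $\int|f|^2\,d\nu_Z\le C\|f\|^2$ for all $f\in H^2$, and let $\|\nu_Z\|_{\mathrm{geo}}$ be its geometric Carleson norm, the smallest $C$ such that $\nu_Z(Q(\theta_0,\delta))\le C\delta$ for all Carleson squares $Q(\theta_0,\delta)=\{re^{i\theta} : 1-\delta\le r\le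 1,\ |\theta-\theta_0|\le\delta\}$ with $\theta_0\in\mathbb R$, $0<\delta\le 1$. **Theorem.** There is an absolute constant $c>0$ with the following property. Let $\varphi,\psi$ be holomorphic self-maps of $\mathbb D$, let $n\ge 1$, and let $Z=\{z_1,\dots,z_n\}$ be $n$ distinct points of $\mathbb D$ such that $W=\varphi(Z)\cup\psi(Z)$ has exactly $2n$ points. Then the composition operators $C_\varphi f=f\circ\varphi$ and $C_\psi f=f\circ\psi$ are bounded on $H^2$, $$a_n(C_\varphi-C_\psi)\ \ge\ M(W)^{-1}\,\|\nu_Z\|_{\mathcal C}^{-1/2}\left(\inf_{1\le j\le n}\left(\frac{1-|z_j|^2}{1-|\varphi(z_j)|^2}+\frac{1-|z_j|^2}{1-|\psi(z_j)|^2}\right)\right)^{1/2},$$ and $$a_n(C_\varphi-C_\psi)\ \ge\ c\,M(W)^{-1}\,\|\nu_Z\|_{\mathrm{geo}}^{-1/2}\left(\inf_{1\le j\le n}\left(\frac{1-|z_j|^2}{1-|\varphi(z_j)|^2}+\frac{1-|z_j|^2}{1-|\psi(z_j)|^2}\right)\right)^{1/2}.$$ -/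

import Mathlib

open scoped ENNReal

noncomputable section

/-- The Hardy space `H²` of the unit disc, given by its Taylor coefficients: the power series
`∑ aₖ zᵏ` with `∑ |aₖ|² < ∞`, with norm `(∑ |aₖ|²)^(1/2)`. -/
abbrev HardySpace : Type := lp (fun _ : ℕ => ℂ) 2

/-- The value at `z` of the holomorphic function on the unit disc represented by `f`
(only used for `|z| < 1`, where the series converges). -/
def HardySpace.eval (f : HardySpace) (z : ℂ) : ℂ := ∑' k : ℕ, f k * z ^ k

/-- `φ` is a holomorphic self-map of the open unit disc. -/
def IsHolomorphicSelfMap (φ : ℂ → ℂ) : Prop :=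
  DifferentiableOn ℂ φ (Metric.ball 0 1) ∧ Set.MapsTo φ (Metric.ball 0 1) (Metric.ball 0 1)

/-- The bounded operator `C` on `H²` is the composition operator `f ↦ f ∘ φ`. Since an element of
`H²` is determined by its values on the disc, there is at most one such `C`. -/
def IsCompositionOperator (φ : ℂ → ℂ) (C : HardySpace →L[ℂ] HardySpace) : Prop :=
  ∀ (f : HardySpace), ∀ z ∈ Metric.ball (0 : ℂ) 1, (C f).eval z = f.eval (φ z)

/-- The `n`-th approximation number `aₙ(T) = inf {‖T - R‖ : rank R < n}`, for `n ≥ 1`. -/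
def approximationNumber {H K : Type*} [NormedAddCommGroup H] [InnerProductSpace ℂ H]
    [NormedAddCommGroup K] [InnerProductSpace ℂ K] (n : ℕ) (T : H →L[ℂ] K) : ℝ :=
  sInf {c : ℝ | ∃ R : H →L[ℂ] K, LinearMap.rank (R : H →ₗ[ℂ] K) < (n : Cardinal) ∧ c = ‖T - R‖}

/-- The constant of interpolation `M(S)`: the smallest `C` such that all data `a` on `S` with
`∑ |a(w)|² (1 - |w|²) < ∞` are interpolated by some `f ∈ H²` with
`‖f‖ ≤ C (∑ |a(w)|² (1 - |w|²))^(1/2)`. -/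
def interpolationConstant (S : Set ℂ) : ℝ :=
  sInf {C : ℝ | 0 ≤ C ∧ ∀ a : S → ℂ,
    Summable (fun w : S => ‖a w‖ ^ 2 * (1 - ‖(w : ℂ)‖ ^ 2)) →
      ∃ f : HardySpace, (∀ w : S, f.eval w = a w) ∧
        ‖f‖ ≤ C * √(∑' w : S, ‖a w‖ ^ 2 * (1 - ‖(w : ℂ)‖ ^ 2))}

/-- The measure `ν_Z = ∑ⱼ (1 - |zⱼ|²) δ_{zⱼ}`. -/
def pointMeasure {n : ℕ} (z : Fin n → ℂ) : MeasureTheory.Measure ℂ :=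
  ∑ j, ENNReal.ofReal (1 - ‖z j‖ ^ 2) • MeasureTheory.Measure.dirac (z j)

/-- The Carleson square `{r e^{iθ} : 1 - δ ≤ r ≤ 1, |θ - θ₀| ≤ δ}`, for `0 < δ ≤ 1`. -/
def carlesonSquare (θ₀ δ : ℝ) : Set ℂ :=
  {z : ℂ | ∃ r θ : ℝ, z = r * Complex.exp (θ * Complex.I) ∧ 1 - δ ≤ r ∧ r ≤ 1 ∧ |θ - θ₀| ≤ δ}

/-- The geometric Carleson norm of a measure carried by the closed disc: the smallest `C` with
`μ(Q(θ₀, δ)) ≤ C δ` for all Carleson squares. -/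
def geometricCarlesonNorm (μ : MeasureTheory.Measure ℂ) : ℝ :=
  sInf {C : ℝ | 0 ≤ C ∧ ∀ θ₀ δ : ℝ, 0 < δ → δ ≤ 1 →
    μ (carlesonSquare θ₀ δ) ≤ ENNReal.ofReal (C * δ)}

/-- The Carleson norm of a measure carried by the open disc with respect to `H²`: the smallest `C`
with `∫ |f|² dμ ≤ C ‖f‖²` for all `f ∈ H²`. -/
def carlesonNorm (μ : MeasureTheory.Measure ℂ) : ℝ :=
  sInf {C : ℝ | 0 ≤ C ∧ ∀ f : HardySpace,
    ∫⁻ z, ENNReal.ofReal (‖f.eval z‖ ^ 2) ∂μ ≤ ENNReal.ofReal (C * ‖f‖ ^ 2)}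

end

open Complex ComplexConjugate Metric

/-! ### Square-summable sequences as functions on the disc -/

namespace HardySpace

/-! The lower bound tests `Cφ - Cψ - R` on one function. Interpolation on `W` can be made linear in
the data, so the vectors `c ∈ ℂⁿ` index an `n`-dimensional family of data: `cᵢ / (1 - |φ(zᵢ)|²)` at
`φ(zᵢ)` and `-cᵢ / (1 - |ψ(zᵢ)|²)` at `ψ(zᵢ)`. As `rank R < n`, some `c ≠ 0` has its interpolant `f`
killed by `R`. With `κᵢ = 1/(1 - |φ(zᵢ)|²) + 1/(1 - |ψ(zᵢ)|²)`, the image of `f` takes the value `cᵢ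
κᵢ` at `zᵢ`, while `‖f‖² ≤ C² ∑ |cᵢ|² κᵢ`. The Carleson embedding at the `zᵢ` bounds `∑ (1 - |zᵢ|²)
|cᵢ κᵢ|²` from above, and the infimum bounds it from below by a multiple of the same `∑ |cᵢ|² κᵢ`,
which cancels (`le_mul_norm_sub_of_interpolation`).

The geometric version needs the Carleson embedding theorem with an absolute constant. A dyadic
decomposition turns the geometric condition into a bound on normalised reproducing kernels
(`sum_reproducingKernel_le`), and a Schur-type test turns that into the embedding
(`HardySpace.sum_norm_eval_sq_le`).

Boundedness of composition operators is Littlewood subordination without boundary values: `|f|²`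
lies below the real part of a holomorphic function built from the resolvent of the backward shift
(`HardySpace.majorant`), and the mean value property survives composition with `φ`. -/

theorem memlp_iff {a : ℕ → ℂ} : Memℓp a 2 ↔ Summable fun k => ‖a k‖ ^ 2 := by
  have := memℓp_gen_iff (E := fun _ : ℕ => ℂ) (p := 2) (f := a) (by norm_num)
  simpa using this

theorem summable_norm_sq (f : HardySpace) : Summable fun k => ‖f k‖ ^ 2 :=
  memlp_iff.1 (lp.memℓp f)

theorem norm_sq_eq_tsum (f : HardySpace) : ‖f‖ ^ 2 = ∑' k, ‖f k‖ ^ 2 := by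
  have := lp.norm_rpow_eq_tsum (p := 2) (by norm_num) f
  simpa using this

/-- The reproducing kernel of the Hardy space at a point of the disc. -/
noncomputable def kernel (z : ℂ) (hz : ‖z‖ < 1) : HardySpace :=
  ⟨fun k => (starRingEnd ℂ) z ^ k, memlp_iff.2 (by
    simp only [norm_pow, RCLike.norm_conj, fun k : ℕ => pow_right_comm ‖z‖ k 2]
    exact summable_geometric_of_lt_one (sq_nonneg ‖z‖) (pow_lt_one₀ (norm_nonneg z) hz two_ne_zero))⟩

theorem kernel_apply (z : ℂ) (hz : ‖z‖ < 1) (k : ℕ) :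
    kernel z hz k = (starRingEnd ℂ) z ^ k := rfl

theorem hasSum_eval (f : HardySpace) {z : ℂ} (hz : ‖z‖ < 1) :
    HasSum (fun k => f k * z ^ k) (inner ℂ (kernel z hz) f) := by
  simpa [kernel_apply, mul_comm] using
    lp.hasSum_inner (𝕜 := ℂ) (G := fun _ : ℕ => ℂ) (kernel z hz) f

theorem eval_eq_inner (f : HardySpace) {z : ℂ} (hz : ‖z‖ < 1) :
    f.eval z = inner ℂ (kernel z hz) f :=
  (hasSum_eval f hz).tsum_eq

theorem inner_kernel_kernel {z w : ℂ} (hz : ‖z‖ < 1) (hw : ‖w‖ < 1) :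
    inner ℂ (kernel z hz) (kernel w hw) = (1 - z * (starRingEnd ℂ) w)⁻¹ := by
  rw [← eval_eq_inner, eval]
  simp only [kernel_apply, ← mul_pow]
  rw [tsum_geometric_of_norm_lt_one, mul_comm]
  simp only [norm_mul, RCLike.norm_conj]
  nlinarith [norm_nonneg z, norm_nonneg w]

theorem eval_zero_right (f : HardySpace) : f.eval 0 = f 0 := by
  rw [eval, tsum_eq_single 0]
  · simp
  · intro k hk
    simp [hk]

/-- The backward shift as a linear map. -/
noncomputable def shiftLinear : HardySpace →ₗ[ℂ] HardySpace where
  toFun f := ⟨fun k => f (k + 1), memlp_iff.2 ((summable_nat_add_iff 1).2 (summable_norm_sq f))⟩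
  map_add' f g := by ext k; rfl
  map_smul' c f := by ext k; rfl

theorem norm_sq_eq_add_shiftLinear (f : HardySpace) :
    ‖f‖ ^ 2 = ‖f 0‖ ^ 2 + ‖shiftLinear f‖ ^ 2 := by
  rw [norm_sq_eq_tsum f, norm_sq_eq_tsum (shiftLinear f), (summable_norm_sq f).tsum_eq_zero_add]
  rfl

/-- The backward shift `f ↦ (f - f(0)) / z`. -/
noncomputable def shift : HardySpace →L[ℂ] HardySpace :=
  shiftLinear.mkContinuous 1 fun f => by
    have := norm_sq_eq_add_shiftLinear f
    rw [one_mul]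
    exact (abs_le_of_sq_le_sq' (by nlinarith [sq_nonneg ‖f 0‖]) (norm_nonneg f)).2

theorem norm_sq_eq_add_shift (f : HardySpace) : ‖f‖ ^ 2 = ‖f 0‖ ^ 2 + ‖shift f‖ ^ 2 :=
  norm_sq_eq_add_shiftLinear f

theorem norm_shift_le : ‖shift‖ ≤ 1 :=
  LinearMap.mkContinuous_norm_le _ zero_le_one _

theorem eval_eq_add_shift (f : HardySpace) {z : ℂ} (hz : ‖z‖ < 1) :
    f.eval z = f 0 + z * (shift f).eval z := by
  rw [eval, (hasSum_eval f hz).summable.tsum_eq_zero_add, eval, ← tsum_mul_left]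
  simp only [pow_zero, mul_one]
  congr 1
  refine tsum_congr fun k => ?_
  change f (k + 1) * z ^ (k + 1) = z * (f (k + 1) * z ^ k)
  ring

/-- The resolvent `(1 - z S*)⁻¹` of the backward shift. -/
noncomputable def resolvent (z : ℂ) : HardySpace →L[ℂ] HardySpace :=
  Ring.inverse (1 - z • shift)

theorem isUnit_one_sub_smul_shift {z : ℂ} (hz : ‖z‖ < 1) : IsUnit (1 - z • shift) := by
  refine isUnit_one_sub_of_norm_lt_one ?_
  rw [norm_smul]
  nlinarith [norm_shift_le, norm_nonneg z, norm_nonneg shift]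

theorem resolvent_sub (f : HardySpace) {z : ℂ} (hz : ‖z‖ < 1) :
    resolvent z f - z • shift (resolvent z f) = f := by
  have h := Ring.mul_inverse_cancel _ (isUnit_one_sub_smul_shift hz)
  have := congrArg (fun A : HardySpace →L[ℂ] HardySpace => A f) h
  simpa [resolvent] using this

/-- With `g = resolvent z f`, evaluating `f = g - z • shift g` at `z` leaves only the constant
coefficient of `g`. Point evaluation thus depends on `z` through an operator inverse, whence
holomorphy. -/
theorem eval_eq_resolvent_apply_zero (f : HardySpace) {z : ℂ} (hz : ‖z‖ < 1) :
    f.eval z = resolvent z f 0 := by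
  conv_lhs => rw [← resolvent_sub f hz]
  rw [eval_eq_inner _ hz, inner_sub_right, inner_smul_right, ← eval_eq_inner _ hz,
    ← eval_eq_inner _ hz, eval_eq_add_shift _ hz]
  ring

theorem differentiableOn_resolvent : DifferentiableOn ℂ resolvent (Metric.ball 0 1) := by
  intro z hz
  have hz : ‖z‖ < 1 := by simpa using hz
  obtain ⟨u, hu⟩ := isUnit_one_sub_smul_shift hz
  have h1 : DifferentiableAt ℂ (Ring.inverse : (HardySpace →L[ℂ] HardySpace) → _)
      (1 - z • shift) := by
    rw [← hu]; exact differentiableAt_inverse u.isUnit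
  have h2 : DifferentiableAt ℂ (fun z : ℂ => (1 - z • shift : HardySpace →L[ℂ] HardySpace)) z := by
    fun_prop
  exact (DifferentiableAt.comp z h1 h2).differentiableWithinAt

theorem differentiableOn_eval (f : HardySpace) :
    DifferentiableOn ℂ f.eval (Metric.ball 0 1) := by
  have h : DifferentiableOn ℂ (fun z => inner ℂ (kernel 0 (by simp)) (resolvent z f))
      (Metric.ball 0 1) := by
    have := differentiableOn_resolvent
    have h2 := this.clm_apply (differentiableOn_const f)
    exact (innerSL ℂ (kernel 0 (by simp))).differentiable.comp_differentiableOn h2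
  refine h.congr fun z hz => ?_
  rw [eval_eq_resolvent_apply_zero f (by simpa using hz), ← eval_eq_inner, eval_zero_right]

/-- Coefficients are removed one at a time: if `g` vanishes on the disc, so does `shift g`, by
division by `z` off the origin and by continuity at it. -/
theorem eq_zero_of_eval_eq_zero (f : HardySpace)
    (h : ∀ z ∈ Metric.ball (0 : ℂ) 1, f.eval z = 0) : f = 0 := by
  have key : ∀ k : ℕ, ∀ g : HardySpace, (∀ z ∈ Metric.ball (0 : ℂ) 1, g.eval z = 0) →
      g k = 0 := by
    intro k
    induction k with
    | zero => intro g hg; rw [← eval_zero_right]; exact hg 0 (by simp)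
    | succ k ih =>
      intro g hg
      refine ih (shift g) ?_
      have hne : ∀ z ∈ Metric.ball (0 : ℂ) 1, z ≠ 0 → (shift g).eval z = 0 := by
        intro z hz hz0
        have := eval_eq_add_shift g (z := z) (by simpa using hz)
        rw [hg z hz, ← eval_zero_right, hg 0 (by simp), zero_add] at this
        exact (mul_eq_zero.1 this.symm).resolve_left hz0
      intro z hz
      by_cases hz0 : z = 0
      · subst hz0
        have hc : ContinuousAt (shift g).eval 0 :=
          ((differentiableOn_eval (shift g)).differentiableAt
            (Metric.isOpen_ball.mem_nhds hz)).continuousAt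
        have h0 : Filter.Tendsto (shift g).eval (nhdsWithin 0 {0}ᶜ) (nhds 0) := by
          refine tendsto_const_nhds.congr' ?_
          filter_upwards [self_mem_nhdsWithin,
            mem_nhdsWithin_of_mem_nhds (Metric.isOpen_ball.mem_nhds hz)] with w hw hw1
          exact (hne w hw1 hw).symm
        exact tendsto_nhds_unique (hc.tendsto.mono_left nhdsWithin_le_nhds) h0
      · exact hne z hz hz0
  ext k
  exact key k f h

theorem ext_eval {f g : HardySpace} (h : ∀ z ∈ Metric.ball (0 : ℂ) 1, f.eval z = g.eval z) :
    f = g := by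
  refine sub_eq_zero.1 (eq_zero_of_eval_eq_zero _ fun z hz => ?_)
  have hz' : ‖z‖ < 1 := by simpa using hz
  rw [eval_eq_inner _ hz', inner_sub_right, ← eval_eq_inner _ hz', ← eval_eq_inner _ hz', h z hz,
    sub_self]

theorem eval_add (f g : HardySpace) {z : ℂ} (hz : ‖z‖ < 1) :
    (f + g).eval z = f.eval z + g.eval z := by
  simp only [eval_eq_inner _ hz, inner_add_right]

theorem eval_sub (f g : HardySpace) {z : ℂ} (hz : ‖z‖ < 1) :
    (f - g).eval z = f.eval z - g.eval z := by
  simp only [eval_eq_inner _ hz, inner_sub_right]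

theorem eval_smul (c : ℂ) (f : HardySpace) {z : ℂ} (hz : ‖z‖ < 1) :
    (c • f).eval z = c * f.eval z := by
  simp only [eval_eq_inner _ hz, inner_smul_right]

end HardySpace

/-! ### Carleson embedding for finite sums of point masses -/

theorem norm_one_sub_mul_conj_comm (z w : ℂ) : ‖1 - z * conj w‖ = ‖1 - w * conj z‖ := by
  rw [← RCLike.norm_conj]
  simp [mul_comm]

theorem norm_one_sub_mul_conj_sq (z w : ℂ) :
    ‖1 - z * conj w‖ ^ 2 = ‖z - w‖ ^ 2 + (1 - ‖z‖ ^ 2) * (1 - ‖w‖ ^ 2) := by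
  simp only [← normSq_eq_norm_sq, normSq_apply, sub_re, sub_im, mul_re, mul_im, conj_re, conj_im,
    one_re, one_im]
  ring

theorem norm_sub_le_norm_one_sub_mul_conj {z w : ℂ} (hz : ‖z‖ < 1) (hw : ‖w‖ < 1) :
    ‖z - w‖ ≤ ‖1 - z * conj w‖ := by
  refine (abs_le_of_sq_le_sq' ?_ (norm_nonneg _)).2
  rw [norm_one_sub_mul_conj_sq]
  have h1 : ‖z‖ ^ 2 ≤ 1 := pow_le_one₀ (norm_nonneg z) hz.le
  have h2 : ‖w‖ ^ 2 ≤ 1 := pow_le_one₀ (norm_nonneg w) hw.le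
  nlinarith [mul_nonneg (sub_nonneg.2 h1) (sub_nonneg.2 h2)]

/-- `‖1 - z * conj w‖` plays the role of a distance between `z` and `w`, and the Schur test rests on
this inequality. -/
theorem norm_one_sub_mul_conj_triangle {x s t : ℂ} (hx : ‖x‖ < 1) (hs : ‖s‖ < 1) (ht : ‖t‖ < 1) :
    ‖1 - x * conj t‖ ≤ ‖1 - x * conj s‖ + ‖1 - s * conj t‖ := by
  have h : 1 - x * conj t = (s - x) * conj t + (1 - s * conj t) := by ring
  rw [h]
  refine (norm_add_le _ _).trans (add_le_add_left ?_ _)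
  rw [norm_mul, RCLike.norm_conj, norm_sub_rev]
  exact (mul_le_of_le_one_right (norm_nonneg _) ht.le).trans
    (norm_sub_le_norm_one_sub_mul_conj hx hs)

theorem one_sub_norm_le_norm_one_sub_mul_conj {z w : ℂ} (hz : ‖z‖ < 1) :
    1 - ‖w‖ ≤ ‖1 - z * conj w‖ := by
  have h := norm_sub_norm_le (1 : ℂ) (z * conj w)
  rw [norm_one, norm_mul, RCLike.norm_conj] at h
  nlinarith [norm_nonneg z, norm_nonneg w]

theorem norm_one_sub_mul_conj_pos {z w : ℂ} (hz : ‖z‖ < 1) (hw : ‖w‖ < 1) :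
    0 < ‖1 - z * conj w‖ :=
  lt_of_lt_of_le (sub_pos.2 hw) (one_sub_norm_le_norm_one_sub_mul_conj hz)

section SchurTest

variable {ι : Type*} [Fintype ι]

/-- The Vinogradov–Senichkin test for the quadratic form of a kernel. -/
theorem sum_kernel_le_of_composition_le {m h : ι → ℝ} {k : ι → ι → ℝ} {C : ℝ} (hm : ∀ i, 0 ≤ m i)
    (hh : ∀ i, 0 ≤ h i) (hC : 0 ≤ C)
    (hk : ∀ t x, ∑ s, m s * (k t s * k x s) ≤ C * (k t x + k x t)) :
    ∑ t, ∑ x, m t * m x * k t x * (h t * h x) ≤ 2 * C * ∑ t, m t * h t ^ 2 := by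
  set S := ∑ t, ∑ x, m t * m x * k t x * (h t * h x) with hS
  set P := ∑ t, m t * h t ^ 2 with hP
  have hP0 : 0 ≤ P := Finset.sum_nonneg fun t _ => mul_nonneg (hm t) (sq_nonneg _)
  have hS1 : S = ∑ x, (√(m x) * h x) * (√(m x) * ∑ t, m t * h t * k t x) := by
    rw [hS, Finset.sum_comm]
    refine Finset.sum_congr rfl fun x _ => ?_
    rw [show (√(m x) * h x) * (√(m x) * ∑ t, m t * h t * k t x)
      = (√(m x) * √(m x)) * h x * ∑ t, m t * h t * k t x by ring, Real.mul_self_sqrt (hm x),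
      Finset.mul_sum]
    exact Finset.sum_congr rfl fun t _ => by ring
  -- Cauchy–Schwarz produces the composed kernel `∑ s, m s * (k t s * k x s)`, which `hk` returns to
  -- `k`. The result is `S² ≤ 2 C P S`, so `S` can be divided out.
  have hCS := Finset.sum_mul_sq_le_sq_mul_sq Finset.univ (fun x => √(m x) * h x)
    (fun x => √(m x) * ∑ t, m t * h t * k t x)
  rw [← hS1] at hCS
  simp only [mul_pow, Real.sq_sqrt (hm _)] at hCS
  have h2 : ∑ s, m s * (∑ t, m t * h t * k t s) ^ 2
      = ∑ t, ∑ x, m t * h t * (m x * h x) * ∑ s, m s * (k t s * k x s) := by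
    simp only [sq, Finset.sum_mul_sum]
    simp only [Finset.mul_sum]
    rw [Finset.sum_comm]
    refine Finset.sum_congr rfl fun t _ => ?_
    rw [Finset.sum_comm]
    exact Finset.sum_congr rfl fun x _ => Finset.sum_congr rfl fun s _ => by ring
  have h3 : ∑ t, ∑ x, m t * h t * (m x * h x) * ∑ s, m s * (k t s * k x s) ≤ 2 * C * S := by
    calc _ ≤ ∑ t, ∑ x, m t * h t * (m x * h x) * (C * (k t x + k x t)) :=
          Finset.sum_le_sum fun t _ => Finset.sum_le_sum fun x _ =>
            mul_le_mul_of_nonneg_left (hk t x)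
              (mul_nonneg (mul_nonneg (hm t) (hh t)) (mul_nonneg (hm x) (hh x)))
      _ = C * S + C * ∑ t, ∑ x, m x * m t * k x t * (h x * h t) := by
          simp only [hS, Finset.mul_sum, ← Finset.sum_add_distrib]
          exact Finset.sum_congr rfl fun t _ => Finset.sum_congr rfl fun x _ => by ring
      _ = 2 * C * S := by rw [Finset.sum_comm, ← hS]; ring
  rw [h2] at hCS
  rcases le_or_gt S 0 with hS0 | hS0
  · exact hS0.trans (by positivity)
  · have : S * S ≤ (2 * C * P) * S := by nlinarith
    exact le_of_mul_le_mul_right this hS0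

theorem one_div_mul_le {a b D : ℝ} (ha : 0 < a) (hb : 0 < b) (hD : 0 < D) (h : D ≤ a + b) :
    1 / (a ^ 2 * b ^ 2) ≤ 2 * (1 / a ^ 2 + 1 / b ^ 2) / D ^ 2 := by
  rw [div_add_div _ _ (by positivity) (by positivity), mul_div_assoc', div_div,
    div_le_div_iff₀ (by positivity) (by positivity)]
  have : D ^ 2 ≤ 2 * (1 * b ^ 2 + a ^ 2 * 1) := by
    nlinarith [sq_nonneg (a - b), pow_le_pow_left₀ hD.le h 2]
  nlinarith [mul_le_mul_of_nonneg_right this (by positivity : 0 ≤ a ^ 2 * b ^ 2)]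

variable {z : ι → ℂ} {m : ι → ℝ} {C : ℝ}

/-- The triangle inequality lets the distance from `z t` to `z x` replace one of the two distances
to `z s`. What remains is a sum bounded by `C`. -/
theorem sum_szegoSq_comp_le (hz : ∀ i, ‖z i‖ < 1) (hm : ∀ i, 0 ≤ m i)
    (hC : ∀ t, ∑ s, m s * ((1 - ‖z t‖ ^ 2) / ‖1 - z t * conj (z s)‖ ^ 2) ≤ C) (t x : ι) :
    ∑ s, m s * ((1 - ‖z t‖ ^ 2) / ‖1 - z t * conj (z s)‖ ^ 2 *
        ((1 - ‖z x‖ ^ 2) / ‖1 - z x * conj (z s)‖ ^ 2)) ≤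
      2 * C * ((1 - ‖z t‖ ^ 2) / ‖1 - z t * conj (z x)‖ ^ 2 +
        (1 - ‖z x‖ ^ 2) / ‖1 - z x * conj (z t)‖ ^ 2) := by
  have hd : ∀ i, 0 ≤ 1 - ‖z i‖ ^ 2 := fun i =>
    sub_nonneg.2 (pow_le_one₀ (norm_nonneg _) (hz i).le)
  rw [norm_one_sub_mul_conj_comm (z x) (z t)]
  set D := ‖1 - z t * conj (z x)‖ with hD
  have hDpos : 0 < D := norm_one_sub_mul_conj_pos (hz t) (hz x)
  calc _ ≤ ∑ s, (2 * (1 - ‖z x‖ ^ 2) / D ^ 2 *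
          (m s * ((1 - ‖z t‖ ^ 2) / ‖1 - z t * conj (z s)‖ ^ 2)) +
        2 * (1 - ‖z t‖ ^ 2) / D ^ 2 *
          (m s * ((1 - ‖z x‖ ^ 2) / ‖1 - z x * conj (z s)‖ ^ 2))) := by
        refine Finset.sum_le_sum fun s _ => ?_
        have h := one_div_mul_le (norm_one_sub_mul_conj_pos (hz t) (hz s))
          (norm_one_sub_mul_conj_pos (hz x) (hz s)) hDpos (by
            rw [norm_one_sub_mul_conj_comm (z x) (z s)]
            exact norm_one_sub_mul_conj_triangle (hz t) (hz s) (hz x))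
        have h' := mul_le_mul_of_nonneg_left h
          (mul_nonneg (hm s) (mul_nonneg (hd t) (hd x)))
        refine le_trans (le_of_eq ?_) (h'.trans (le_of_eq ?_))
        · rw [div_mul_div_comm]; ring
        · ring
    _ ≤ 2 * (1 - ‖z x‖ ^ 2) / D ^ 2 * C + 2 * (1 - ‖z t‖ ^ 2) / D ^ 2 * C := by
        rw [Finset.sum_add_distrib, ← Finset.mul_sum, ← Finset.mul_sum]
        have hx := hd x
        have ht := hd t
        exact add_le_add (mul_le_mul_of_nonneg_left (hC t) (by positivity))
          (mul_le_mul_of_nonneg_left (hC x) (by positivity))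
    _ = _ := by ring

/-- Since `1 - ab ≤ (1 - a) + (1 - b)` for `a, b ≤ 1`, the Poisson kernel is at most the symmetrised
kernel of the test. The constant is `2 · 2 · 2C`: composition, test, symmetrisation. -/
theorem sum_poisson_le (hz : ∀ i, ‖z i‖ < 1) (hm : ∀ i, 0 ≤ m i) (hC0 : 0 ≤ C)
    (hC : ∀ t, ∑ s, m s * ((1 - ‖z t‖ ^ 2) / ‖1 - z t * conj (z s)‖ ^ 2) ≤ C)
    {h : ι → ℝ} (hh : ∀ i, 0 ≤ h i) :
    ∑ t, ∑ x, m t * m x * ((1 - ‖z t * conj (z x)‖ ^ 2) / ‖1 - z t * conj (z x)‖ ^ 2) *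
      (h t * h x) ≤ 8 * C * ∑ t, m t * h t ^ 2 := by
  have key := sum_kernel_le_of_composition_le
    (k := fun t s => (1 - ‖z t‖ ^ 2) / ‖1 - z t * conj (z s)‖ ^ 2) hm hh
    (mul_nonneg zero_le_two hC0) (sum_szegoSq_comp_le hz hm hC)
  set S := ∑ t, ∑ x, m t * m x * ((1 - ‖z t‖ ^ 2) / ‖1 - z t * conj (z x)‖ ^ 2) * (h t * h x)
    with hS
  have hle : ∑ t, ∑ x, m t * m x * ((1 - ‖z t * conj (z x)‖ ^ 2) / ‖1 - z t * conj (z x)‖ ^ 2) *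
      (h t * h x) ≤ S + ∑ t, ∑ x, m x * m t * ((1 - ‖z x‖ ^ 2) / ‖1 - z x * conj (z t)‖ ^ 2) *
        (h x * h t) := by
    rw [hS, ← Finset.sum_add_distrib]
    refine Finset.sum_le_sum fun t _ => ?_
    rw [← Finset.sum_add_distrib]
    refine Finset.sum_le_sum fun x _ => ?_
    rw [norm_one_sub_mul_conj_comm (z x) (z t)]
    have h1 : ‖z t‖ ^ 2 ≤ 1 := pow_le_one₀ (norm_nonneg _) (hz t).le
    have h2 : ‖z x‖ ^ 2 ≤ 1 := pow_le_one₀ (norm_nonneg _) (hz x).le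
    have h3 : 1 - ‖z t * conj (z x)‖ ^ 2 ≤ (1 - ‖z t‖ ^ 2) + (1 - ‖z x‖ ^ 2) := by
      rw [norm_mul, RCLike.norm_conj, mul_pow]
      nlinarith [mul_nonneg (sub_nonneg.2 h1) (sub_nonneg.2 h2)]
    have h4 := div_le_div_of_nonneg_right h3 (sq_nonneg ‖1 - z t * conj (z x)‖)
    have h5 := mul_le_mul_of_nonneg_left h4
      (mul_nonneg (mul_nonneg (hm t) (hm x)) (mul_nonneg (hh t) (hh x)))
    rw [add_div] at h5
    linarith
  rw [Finset.sum_comm (f := fun t x => m x * m t *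
    ((1 - ‖z x‖ ^ 2) / ‖1 - z x * conj (z t)‖ ^ 2) * (h x * h t))] at hle
  linarith

end SchurTest

namespace HardySpace

variable {ι : Type*} [Fintype ι] {z : ι → ℂ}

theorem inv_one_sub_add_conj {u : ℂ} (hu : ‖u‖ < 1) :
    (1 - u)⁻¹ + conj u * (1 - conj u)⁻¹ = (((1 - ‖u‖ ^ 2) / ‖1 - u‖ ^ 2 : ℝ) : ℂ) := by
  have h1 : 1 - u ≠ 0 := by
    intro h
    rw [← sub_eq_zero.1 h, norm_one] at hu
    exact lt_irrefl _ hu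
  have h2 : 1 - conj u ≠ 0 := by
    intro h
    refine h1 ?_
    have := congrArg conj h
    simpa using this
  push_cast
  rw [← mul_conj', ← mul_conj', map_sub, map_one]
  field_simp
  ring

/-- The Szegő Gram form is dominated by the Poisson form. -/
theorem norm_sum_kernel_sq_le (hz : ∀ i, ‖z i‖ < 1) (c : ι → ℂ) :
    ‖∑ i, c i • kernel (z i) (hz i)‖ ^ 2 ≤ ∑ i, ∑ j, ‖c i‖ * ‖c j‖ *
      ((1 - ‖z i * conj (z j)‖ ^ 2) / ‖1 - z i * conj (z j)‖ ^ 2) := by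
  set v := ∑ i, c i • kernel (z i) (hz i) with hv
  -- The Gram form of `w` has kernel `conj u / (1 - conj u)`, where `u = z i * conj (z j)`. Adding
  -- it to the Szegő kernel `1 / (1 - u)` gives the Poisson kernel, which is nonnegative, so
  -- absolute values may be taken termwise without loss in the kernel.
  set w := ∑ i, conj (c i * z i) • kernel (z i) (hz i) with hw
  have hvv : inner ℂ v v = ∑ i, ∑ j, conj (c i) * c j * (1 - z i * conj (z j))⁻¹ := by
    simp only [hv, sum_inner, inner_sum]
    simp only [inner_smul_left, inner_smul_right, inner_kernel_kernel]
    rw [Finset.sum_comm]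
    exact Finset.sum_congr rfl fun i _ => Finset.sum_congr rfl fun j _ => by ring
  have hww : inner ℂ w w = ∑ i, ∑ j, conj (c i) * c j *
      (conj (z i * conj (z j)) * (1 - conj (z i * conj (z j)))⁻¹) := by
    simp only [hw, sum_inner, inner_sum]
    simp only [inner_smul_left, inner_smul_right, inner_kernel_kernel, map_mul, conj_conj]
    exact Finset.sum_congr rfl fun i _ => Finset.sum_congr rfl fun j _ => by
      rw [mul_comm (conj (z i)) (z j)]; ring
  have hu : ∀ i j, ‖z i * conj (z j)‖ < 1 := fun i j => by
    rw [norm_mul, RCLike.norm_conj]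
    nlinarith [norm_nonneg (z i), norm_nonneg (z j), hz i, hz j]
  have hsum : inner ℂ v v + inner ℂ w w = ∑ i, ∑ j, conj (c i) * c j *
      (((1 - ‖z i * conj (z j)‖ ^ 2) / ‖1 - z i * conj (z j)‖ ^ 2 : ℝ) : ℂ) := by
    rw [hvv, hww, ← Finset.sum_add_distrib]
    refine Finset.sum_congr rfl fun i _ => ?_
    rw [← Finset.sum_add_distrib]
    refine Finset.sum_congr rfl fun j _ => ?_
    rw [← inv_one_sub_add_conj (hu i j)]
    ring
  rw [inner_self_eq_norm_sq_to_K, inner_self_eq_norm_sq_to_K] at hsum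
  have hre : ‖v‖ ^ 2 + ‖w‖ ^ 2 = ‖inner ℂ v v + inner ℂ w w‖ := by
    rw [inner_self_eq_norm_sq_to_K, inner_self_eq_norm_sq_to_K]
    norm_cast
    exact (abs_of_nonneg (by positivity)).symm
  rw [inner_self_eq_norm_sq_to_K, inner_self_eq_norm_sq_to_K, hsum] at hre
  calc ‖v‖ ^ 2 ≤ ‖v‖ ^ 2 + ‖w‖ ^ 2 := le_add_of_nonneg_right (sq_nonneg _)
    _ ≤ _ := by
      rw [hre]
      refine (norm_sum_le _ _).trans (Finset.sum_le_sum fun i _ => ?_)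
      refine (norm_sum_le _ _).trans (Finset.sum_le_sum fun j _ => ?_)
      rw [norm_mul, norm_mul, RCLike.norm_conj, norm_real, Real.norm_of_nonneg]
      have := pow_le_one₀ (n := 2) (norm_nonneg _) (hu i j).le
      exact div_nonneg (sub_nonneg.2 this) (sq_nonneg _)

/-- The reproducing kernel condition implies the embedding. -/
theorem sum_norm_eval_sq_le {m : ι → ℝ} {C : ℝ} (hz : ∀ i, ‖z i‖ < 1) (hm : ∀ i, 0 ≤ m i)
    (hC0 : 0 ≤ C)
    (hC : ∀ t, ∑ s, m s * ((1 - ‖z t‖ ^ 2) / ‖1 - z t * conj (z s)‖ ^ 2) ≤ C) (f : HardySpace) :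
    ∑ i, m i * ‖f.eval (z i)‖ ^ 2 ≤ 8 * C * ‖f‖ ^ 2 := by
  set S := ∑ i, m i * ‖f.eval (z i)‖ ^ 2 with hS
  -- Duality: `v` is the adjoint of the embedding applied to the values of `f`, so `S = ⟪v, f⟫` and
  -- it suffices that `‖v‖²` is at most a multiple of `S`.
  set v := ∑ i, ((m i : ℂ) * f.eval (z i)) • kernel (z i) (hz i) with hv
  have h1 : inner ℂ v f = (S : ℂ) := by
    simp only [hv, sum_inner, inner_smul_left, ← eval_eq_inner]
    rw [hS]
    push_cast
    refine Finset.sum_congr rfl fun i _ => ?_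
    rw [map_mul, conj_ofReal, mul_assoc, ← conj_mul']
  have h2 : ‖v‖ ^ 2 ≤ 8 * C * S := by
    refine (norm_sum_kernel_sq_le hz _).trans
      (le_trans (le_of_eq ?_) (sum_poisson_le hz hm hC0 hC (fun i => norm_nonneg (f.eval (z i)))))
    refine Finset.sum_congr rfl fun i _ => Finset.sum_congr rfl fun j _ => ?_
    rw [norm_mul, norm_mul, norm_real, norm_real, Real.norm_of_nonneg (hm i),
      Real.norm_of_nonneg (hm j)]
    ring
  have hS0 : 0 ≤ S := Finset.sum_nonneg fun i _ => mul_nonneg (hm i) (sq_nonneg _)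
  have h3 : S ≤ ‖v‖ * ‖f‖ := by
    have := norm_inner_le_norm (𝕜 := ℂ) v f
    rwa [h1, norm_real, Real.norm_of_nonneg hS0] at this
  rcases hS0.eq_or_lt with h0 | h0
  · rw [← h0]; positivity
  · have h4 : S * S ≤ (8 * C * ‖f‖ ^ 2) * S := by
      calc S * S ≤ (‖v‖ * ‖f‖) * (‖v‖ * ‖f‖) := mul_self_le_mul_self hS0 h3
        _ = ‖v‖ ^ 2 * ‖f‖ ^ 2 := by ring
        _ ≤ (8 * C * S) * ‖f‖ ^ 2 := mul_le_mul_of_nonneg_right h2 (sq_nonneg _)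
        _ = _ := by ring
    exact le_of_mul_le_mul_right h4 h0

end HardySpace

/-! ### The geometric Carleson condition -/

/-- For `w = z * conj t` one has `|w| ≥ 1/2`, so `|sin (arg w)| ≤ 2ρ`. Jordan's inequality then
gives `|arg w| ≤ πρ ≤ 4ρ`. -/
theorem mem_carlesonSquare_of_norm_one_sub_mul_conj_le {z t : ℂ} {ρ : ℝ} (hz : ‖z‖ < 1)
    (ht : ‖t‖ < 1) (hρ : 4 * ρ ≤ 1) (h : ‖1 - z * conj t‖ ≤ ρ) :
    z ∈ carlesonSquare (arg t) (4 * ρ) := by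
  set w := z * conj t with hw
  have hρ0 : 0 ≤ ρ := (norm_nonneg _).trans h
  have hre : 1 / 2 ≤ w.re := by
    have := (abs_le.1 ((abs_re_le_norm _).trans h)).2
    rw [sub_re, one_re] at this
    linarith
  have him : |w.im| ≤ ρ := by
    have := (abs_im_le_norm _).trans h
    rwa [sub_im, one_im, zero_sub, abs_neg] at this
  have hwn : 1 / 2 ≤ ‖w‖ := hre.trans ((le_abs_self _).trans (abs_re_le_norm w))
  have harg : |arg w| ≤ 4 * ρ := by
    have h1 := Real.mul_abs_le_abs_sin (abs_arg_le_pi_div_two_iff.2 (by linarith : 0 ≤ re w))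
    rw [sin_arg, abs_div, abs_norm] at h1
    have h2 : |w.im| / ‖w‖ ≤ 2 * ρ := by
      rw [div_le_iff₀ (by linarith)]
      nlinarith
    have h3 : 2 / Real.pi * |arg w| ≤ 2 * ρ := h1.trans h2
    rw [div_mul_eq_mul_div, div_le_iff₀ Real.pi_pos] at h3
    nlinarith [Real.pi_lt_four]
  have ht0 : t ≠ 0 := by
    rintro rfl
    simp [hw] at hre
    linarith
  refine ⟨‖z‖, arg t + arg w, ?_, ?_, hz.le, by simpa using harg⟩
  · have hmul : ((‖w‖ * ‖t‖ : ℝ) : ℂ) * exp ((arg t + arg w : ℝ) * I) = w * t := by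
      push_cast
      rw [add_mul, exp_add]
      calc _ = (‖w‖ * exp (arg w * I)) * (‖t‖ * exp (arg t * I)) := by ring
        _ = _ := by rw [norm_mul_exp_arg_mul_I, norm_mul_exp_arg_mul_I]
    have hwt : w * t = z * (‖t‖ ^ 2 : ℝ) := by
      rw [hw, mul_assoc, conj_mul']
      push_cast
      rfl
    have hn : ‖w‖ * ‖t‖ = ‖z‖ * ‖t‖ ^ 2 := by
      rw [hw, norm_mul, RCLike.norm_conj]; ring
    have htn : ((‖t‖ ^ 2 : ℝ) : ℂ) ≠ 0 := by
      exact_mod_cast pow_ne_zero 2 (norm_ne_zero_iff.2 ht0)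
    refine mul_right_cancel₀ htn ?_
    rw [← hwt, ← hmul, hn]
    push_cast
    ring
  · have := one_sub_norm_le_norm_one_sub_mul_conj (w := z) ht
    rw [norm_one_sub_mul_conj_comm] at this
    linarith

/-- The centres `-3, -1, 1, 3` with half-width `1` cover `[-4, 4]`, which contains every argument.
-/
theorem exists_mem_carlesonSquare_one {z : ℂ} (hz : ‖z‖ < 1) :
    ∃ i : Fin 4, z ∈ carlesonSquare (2 * (i : ℝ) - 3) 1 := by
  have key : ∀ θ₀ : ℝ, |arg z - θ₀| ≤ 1 → z ∈ carlesonSquare θ₀ 1 := fun θ₀ h =>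
    ⟨‖z‖, arg z, (norm_mul_exp_arg_mul_I z).symm, by simp, hz.le, h⟩
  have h1 := neg_pi_lt_arg z
  have h2 := arg_le_pi z
  have h3 := Real.pi_lt_four
  have e : ((0 : Fin 4) : ℝ) = 0 ∧ ((1 : Fin 4) : ℝ) = 1 ∧ ((2 : Fin 4) : ℝ) = 2 ∧
      ((3 : Fin 4) : ℝ) = 3 := by norm_num
  rcases le_total (arg z) (-2) with h | h
  · exact ⟨0, key _ (abs_le.2 (by rw [e.1]; constructor <;> linarith))⟩
  rcases le_total (arg z) 0 with h | h
  · exact ⟨1, key _ (abs_le.2 (by rw [e.2.1]; constructor <;> linarith))⟩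
  rcases le_total (arg z) 2 with h | h
  · exact ⟨2, key _ (abs_le.2 (by rw [e.2.2.1]; constructor <;> linarith))⟩
  · exact ⟨3, key _ (abs_le.2 (by rw [e.2.2.2]; constructor <;> linarith))⟩

section DyadicSum

variable {ι : Type*} [Fintype ι]

/-- A weighted sum of inverse squares is controlled by the growth of the weight. -/
theorem sum_div_sq_le_of_growth {m r : ι → ℝ} {δ B : ℝ} (hm : ∀ i, 0 ≤ m i) (hδ : 0 < δ)
    (hB : 0 ≤ B) (hr : ∀ i, δ ≤ r i)
    (hgrowth : ∀ ρ : ℝ, 0 < ρ → ∑ i with r i ≤ ρ, m i ≤ B * ρ) :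
    ∑ i, m i / r i ^ 2 ≤ 4 * B / δ := by
  have hex : ∀ i, ∃ k : ℕ, (2 : ℝ) ^ k ≤ r i / δ ∧ r i / δ < 2 ^ (k + 1) := fun i =>
    exists_nat_pow_near ((one_le_div hδ).2 (hr i)) one_lt_two
  -- `k i` is the dyadic shell of `i`. Shell `l` contributes at most `B · δ 2^(l+1) / (δ 2^l)² =
  -- (2B/δ) 2^(-l)`.
  choose k hk1 hk2 using hex
  set N := Finset.univ.sup k with hN
  have hpt : ∀ i, m i / r i ^ 2 ≤ ∑ l ∈ Finset.range (N + 1),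
      if r i ≤ δ * 2 ^ (l + 1) then m i / (δ * 2 ^ l) ^ 2 else 0 := by
    intro i
    have hmem : k i ∈ Finset.range (N + 1) :=
      Finset.mem_range.2 (Nat.lt_succ_of_le (Finset.le_sup (Finset.mem_univ i)))
    refine le_trans ?_ (Finset.single_le_sum (f := fun l =>
      if r i ≤ δ * 2 ^ (l + 1) then m i / (δ * 2 ^ l) ^ 2 else 0) (fun l _ => ?_) hmem)
    · have h2 := hk2 i
      rw [div_lt_iff₀ hδ, mul_comm] at h2
      have h1 := hk1 i
      rw [le_div_iff₀ hδ, mul_comm] at h1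
      simp only [h2.le, if_true]
      exact div_le_div_of_nonneg_left (hm i) (by positivity)
        (pow_le_pow_left₀ (by positivity) h1 2)
    · split_ifs
      · exact div_nonneg (hm i) (sq_nonneg _)
      · exact le_rfl
  calc ∑ i, m i / r i ^ 2 ≤ ∑ i, ∑ l ∈ Finset.range (N + 1),
        (if r i ≤ δ * 2 ^ (l + 1) then m i / (δ * 2 ^ l) ^ 2 else 0) :=
        Finset.sum_le_sum fun i _ => hpt i
    _ = ∑ l ∈ Finset.range (N + 1), (∑ i with r i ≤ δ * 2 ^ (l + 1), m i) / (δ * 2 ^ l) ^ 2 := by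
        rw [Finset.sum_comm]
        refine Finset.sum_congr rfl fun l _ => ?_
        rw [← Finset.sum_filter, Finset.sum_div]
    _ ≤ ∑ l ∈ Finset.range (N + 1), 2 * B / δ * (1 / 2) ^ l := by
        refine Finset.sum_le_sum fun l _ => ?_
        rw [div_le_iff₀ (by positivity)]
        refine (hgrowth _ (by positivity)).trans (le_of_eq ?_)
        rw [one_div, inv_pow]
        field_simp
        ring
    _ ≤ 2 * B / δ * 2 := by
        rw [← Finset.mul_sum]
        exact mul_le_mul_of_nonneg_left (sum_geometric_two_le _) (by positivity)
    _ = 4 * B / δ := by ring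

end DyadicSum

section PointMasses

variable {n : ℕ} {z : Fin n → ℂ} {C : ℝ}

theorem sum_filter_le_pointMeasure (hz : ∀ i, ‖z i‖ < 1) (s : Set ℂ) [DecidablePred (z · ∈ s)]
    {c : ℝ} (hc : 0 ≤ c) (h : pointMeasure z s ≤ ENNReal.ofReal c) :
    ∑ i with z i ∈ s, (1 - ‖z i‖ ^ 2) ≤ c := by
  have hd : ∀ i, 0 ≤ 1 - ‖z i‖ ^ 2 := fun i =>
    sub_nonneg.2 (pow_le_one₀ (norm_nonneg _) (hz i).le)
  rw [← ENNReal.ofReal_le_ofReal_iff hc, ENNReal.ofReal_sum_of_nonneg fun i _ => hd i]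
  refine le_trans ?_ h
  rw [pointMeasure, MeasureTheory.Measure.finsetSum_apply, Finset.sum_filter]
  refine Finset.sum_le_sum fun i _ => ?_
  split_ifs with hi
  · simp [MeasureTheory.Measure.dirac_apply_of_mem hi]
  · exact zero_le

theorem sum_one_sub_norm_sq_le (hz : ∀ i, ‖z i‖ < 1) (hC : 0 ≤ C)
    (hgeo : ∀ θ₀ δ : ℝ, 0 < δ → δ ≤ 1 →
      pointMeasure z (carlesonSquare θ₀ δ) ≤ ENNReal.ofReal (C * δ)) :
    ∑ i, (1 - ‖z i‖ ^ 2) ≤ 4 * C := by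
  classical
  have hd : ∀ i, 0 ≤ 1 - ‖z i‖ ^ 2 := fun i =>
    sub_nonneg.2 (pow_le_one₀ (norm_nonneg _) (hz i).le)
  calc ∑ i, (1 - ‖z i‖ ^ 2) ≤ ∑ i, ∑ l : Fin 4,
        (if z i ∈ carlesonSquare (2 * (l : ℝ) - 3) 1 then 1 - ‖z i‖ ^ 2 else 0) := by
        refine Finset.sum_le_sum fun i _ => ?_
        obtain ⟨l, hl⟩ := exists_mem_carlesonSquare_one (hz i)
        refine le_trans ?_ (Finset.single_le_sum (f := fun l : Fin 4 =>
          if z i ∈ carlesonSquare (2 * (l : ℝ) - 3) 1 then 1 - ‖z i‖ ^ 2 else 0)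
          (fun l _ => ?_) (Finset.mem_univ l))
        · simp only [hl, if_true, le_refl]
        · split_ifs
          · exact hd i
          · exact le_rfl
    _ ≤ ∑ l : Fin 4, C * 1 := by
        rw [Finset.sum_comm]
        refine Finset.sum_le_sum fun l _ => ?_
        rw [← Finset.sum_filter]
        exact sum_filter_le_pointMeasure hz _ (by simpa using hC)
          (hgeo _ 1 one_pos le_rfl)
    _ = 4 * C := by simp

/-- A small ball lies in a Carleson square of size `4ρ`. Once `4ρ > 1`, the total mass `4C` is
already below `16Cρ`. -/
theorem sum_near_le (hz : ∀ i, ‖z i‖ < 1) (hC : 0 ≤ C)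
    (hgeo : ∀ θ₀ δ : ℝ, 0 < δ → δ ≤ 1 →
      pointMeasure z (carlesonSquare θ₀ δ) ≤ ENNReal.ofReal (C * δ))
    (t : Fin n) {ρ : ℝ} (hρ : 0 < ρ) :
    ∑ s with ‖1 - z t * conj (z s)‖ ≤ ρ, (1 - ‖z s‖ ^ 2) ≤ 16 * C * ρ := by
  classical
  have hd : ∀ i, 0 ≤ 1 - ‖z i‖ ^ 2 := fun i =>
    sub_nonneg.2 (pow_le_one₀ (norm_nonneg _) (hz i).le)
  rcases le_or_gt (4 * ρ) 1 with h | h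
  · refine le_trans (Finset.sum_le_sum_of_subset_of_nonneg
      (t := Finset.univ.filter fun s => z s ∈ carlesonSquare (arg (z t)) (4 * ρ)) ?_
      fun i _ _ => hd i) ((sum_filter_le_pointMeasure hz _ (by positivity)
        (hgeo (arg (z t)) (4 * ρ) (by linarith) h)).trans ?_)
    · intro s hs
      rw [Finset.mem_filter] at hs ⊢
      refine ⟨hs.1, mem_carlesonSquare_of_norm_one_sub_mul_conj_le (hz s) (hz t) h ?_⟩
      rw [norm_one_sub_mul_conj_comm]
      exact hs.2
    · nlinarith [mul_nonneg hC hρ.le]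
  · refine (Finset.sum_le_sum_of_subset_of_nonneg (Finset.filter_subset _ _)
      fun i _ _ => hd i).trans ((sum_one_sub_norm_sq_le hz hC hgeo).trans ?_)
    nlinarith

theorem sum_reproducingKernel_le (hz : ∀ i, ‖z i‖ < 1) (hC : 0 ≤ C)
    (hgeo : ∀ θ₀ δ : ℝ, 0 < δ → δ ≤ 1 →
      pointMeasure z (carlesonSquare θ₀ δ) ≤ ENNReal.ofReal (C * δ))
    (t : Fin n) :
    ∑ s, (1 - ‖z s‖ ^ 2) * ((1 - ‖z t‖ ^ 2) / ‖1 - z t * conj (z s)‖ ^ 2) ≤ 128 * C := by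
  have hd : ∀ i, 0 ≤ 1 - ‖z i‖ ^ 2 := fun i =>
    sub_nonneg.2 (pow_le_one₀ (norm_nonneg _) (hz i).le)
  have hδ : 0 < 1 - ‖z t‖ := sub_pos.2 (hz t)
  have h := sum_div_sq_le_of_growth hd hδ (by positivity : 0 ≤ 16 * C)
    (r := fun s => ‖1 - z t * conj (z s)‖) (fun s => by
      rw [norm_one_sub_mul_conj_comm]
      exact one_sub_norm_le_norm_one_sub_mul_conj (hz s))
    (fun ρ hρ => sum_near_le hz hC hgeo t hρ)
  have h2 : 1 - ‖z t‖ ^ 2 ≤ 2 * (1 - ‖z t‖) := by nlinarith [sq_nonneg (1 - ‖z t‖)]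
  calc _ = (1 - ‖z t‖ ^ 2) * ∑ s, (1 - ‖z s‖ ^ 2) / ‖1 - z t * conj (z s)‖ ^ 2 := by
        rw [Finset.mul_sum]
        exact Finset.sum_congr rfl fun s _ => by ring
    _ ≤ (2 * (1 - ‖z t‖)) * (4 * (16 * C) / (1 - ‖z t‖)) :=
        mul_le_mul h2 h (Finset.sum_nonneg fun s _ => div_nonneg (hd s) (sq_nonneg _))
          (by positivity)
    _ = 128 * C := by field_simp; ring

/-- The geometric Carleson condition implies the embedding of the Hardy space. -/
theorem sum_norm_eval_sq_le_of_geometric (hz : ∀ i, ‖z i‖ < 1) (hC : 0 ≤ C)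
    (hgeo : ∀ θ₀ δ : ℝ, 0 < δ → δ ≤ 1 →
      pointMeasure z (carlesonSquare θ₀ δ) ≤ ENNReal.ofReal (C * δ))
    (f : HardySpace) :
    ∑ i, (1 - ‖z i‖ ^ 2) * ‖f.eval (z i)‖ ^ 2 ≤ 1024 * C * ‖f‖ ^ 2 := by
  have := HardySpace.sum_norm_eval_sq_le hz
    (fun i => sub_nonneg.2 (pow_le_one₀ (norm_nonneg _) (hz i).le))
    (by positivity : 0 ≤ 128 * C) (sum_reproducingKernel_le hz hC hgeo) f
  linarith

end PointMasses

/-! ### Boundedness of composition operators -/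

theorem circleIntegrable_of_continuousOn_ball {E : Type*} [NormedAddCommGroup E] {F : ℂ → E}
    {r : ℝ} (hF : ContinuousOn F (ball 0 1)) (hr0 : 0 ≤ r) (hr1 : r < 1) :
    CircleIntegrable F 0 r :=
  (hF.mono ((sphere_subset_closedBall).trans (closedBall_subset_ball hr1))).circleIntegrable hr0

theorem circleAverage_re_of_differentiableOn_ball {F : ℂ → ℂ} {r : ℝ}
    (hF : DifferentiableOn ℂ F (ball 0 1)) (hr0 : 0 ≤ r) (hr1 : r < 1) :
    Real.circleAverage (fun z => (F z).re) 0 r = (F 0).re := by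
  have h1 : Real.circleAverage F 0 r = F 0 := by
    refine DiffContOnCl.circleAverage (DifferentiableOn.diffContOnCl (hF.mono ?_))
    rw [abs_of_nonneg hr0]
    exact closure_ball_subset_closedBall.trans (closedBall_subset_ball hr1)
  rw [← h1]
  exact reCLM.circleAverage_comp_comm (circleIntegrable_of_continuousOn_ball hF.continuousOn hr0 hr1)

/-- One step of Parseval: in `F = F(0) + zG` the cross term is the real part of a holomorphic
function vanishing at `0`, so it averages to zero. Iterating on `G` gives the coefficient bound that
follows. -/
theorem circleAverage_norm_sq_eq {F : ℂ → ℂ} {r : ℝ} (hF : DifferentiableOn ℂ F (ball 0 1))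
    (hr0 : 0 ≤ r) (hr1 : r < 1) :
    Real.circleAverage (fun z => ‖F z‖ ^ 2) 0 r =
      ‖F 0‖ ^ 2 + r ^ 2 * Real.circleAverage (fun z => ‖dslope F 0 z‖ ^ 2) 0 r := by
  have hG : DifferentiableOn ℂ (dslope F 0) (ball 0 1) :=
    (differentiableOn_dslope (ball_mem_nhds 0 one_pos)).2 hF
  have hdecomp : ∀ z, F z = F 0 + z * dslope F 0 z := fun z => by
    have := sub_smul_dslope F 0 z
    rw [sub_zero, smul_eq_mul] at this
    rw [this]; ring
  have hcross : DifferentiableOn ℂ (fun z => 2 * conj (F 0) * (z * dslope F 0 z)) (ball 0 1) :=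
    (differentiableOn_id.mul hG).const_mul _
  have hpt : Set.EqOn (fun z => ‖F z‖ ^ 2)
      (fun z => (‖F 0‖ ^ 2 + (2 * conj (F 0) * (z * dslope F 0 z)).re) +
        r ^ 2 * ‖dslope F 0 z‖ ^ 2) (sphere 0 |r|) := by
    intro z hz
    rw [abs_of_nonneg hr0, mem_sphere_zero_iff_norm] at hz
    have h2 : r ^ 2 * ‖dslope F 0 z‖ ^ 2 = ‖z * dslope F 0 z‖ ^ 2 := by rw [norm_mul, hz, mul_pow]
    simp only [h2]
    conv_lhs => rw [hdecomp z]
    simp only [← normSq_eq_norm_sq, normSq_add, mul_re (2 * conj (F 0)), mul_re, mul_im, conj_re,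
      conj_im, re_ofNat, im_ofNat]
    ring
  rw [Real.circleAverage_congr_sphere hpt, Real.circleAverage_fun_add, Real.circleAverage_fun_add,
    Real.circleAverage_const, circleAverage_re_of_differentiableOn_ball hcross hr0 hr1]
  · have := Real.circleAverage_fun_smul (a := r ^ 2) (f := fun z => ‖dslope F 0 z‖ ^ 2) (c := (0 : ℂ))
      (R := r)
    simp only [smul_eq_mul] at this
    rw [this]
    simp
  · exact circleIntegrable_const _ _ _
  · exact circleIntegrable_of_continuousOn_ball (continuous_re.comp_continuousOn hcross.continuousOn)
      hr0 hr1
  · exact (circleIntegrable_const _ _ _).add (circleIntegrable_of_continuousOn_ball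
      (continuous_re.comp_continuousOn hcross.continuousOn) hr0 hr1)
  · exact circleIntegrable_of_continuousOn_ball
      (continuousOn_const.mul (hG.continuousOn.norm.pow 2)) hr0 hr1

theorem sum_norm_coeff_sq_le {F : ℂ → ℂ} {p : FormalMultilinearSeries ℂ ℂ ℂ} {r : ℝ}
    (hF : DifferentiableOn ℂ F (ball 0 1)) (hp : HasFPowerSeriesAt F p 0)
    (hr0 : 0 ≤ r) (hr1 : r < 1) (N : ℕ) :
    ∑ k ∈ Finset.range N, (r ^ 2) ^ k * ‖p.coeff k‖ ^ 2 ≤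
      Real.circleAverage (fun z => ‖F z‖ ^ 2) 0 r := by
  induction N generalizing F p with
  | zero =>
    simpa using Real.circleAverage_nonneg_of_nonneg (fun z _ => sq_nonneg ‖F z‖)
  | succ N ih =>
    have hG : DifferentiableOn ℂ (dslope F 0) (ball 0 1) :=
      (differentiableOn_dslope (ball_mem_nhds 0 one_pos)).2 hF
    have h := ih hG hp.has_fpower_series_dslope_fslope
    rw [circleAverage_norm_sq_eq hF hr0 hr1, Finset.sum_range_succ']
    have h0 : p.coeff 0 = F 0 := hp.coeff_zero 1
    rw [h0, pow_zero, one_mul, add_comm]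
    refine add_le_add_right (le_trans (le_of_eq ?_) (mul_le_mul_of_nonneg_left h (sq_nonneg r))) _
    rw [Finset.mul_sum]
    refine Finset.sum_congr rfl fun k _ => ?_
    rw [FormalMultilinearSeries.coeff_fslope]
    ring

/-- A holomorphic function with bounded quadratic means belongs to the Hardy space. -/
theorem exists_hardySpace_of_circleAverage_le {F : ℂ → ℂ} {B : ℝ} (hB : 0 ≤ B)
    (hF : DifferentiableOn ℂ F (ball 0 1))
    (hmean : ∀ r, 0 ≤ r → r < 1 → Real.circleAverage (fun z => ‖F z‖ ^ 2) 0 r ≤ B ^ 2) :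
    ∃ g : HardySpace, (∀ z ∈ ball (0 : ℂ) 1, g.eval z = F z) ∧ ‖g‖ ≤ B := by
  set p := cauchyPowerSeries F 0 (1 / 2) with hpdef
  have hp : HasFPowerSeriesAt F p 0 :=
    ((hF.mono (closedBall_subset_ball (by norm_num))).hasFPowerSeriesOnBall
      (R := 1 / 2) (by norm_num)).hasFPowerSeriesAt
  have hcoeff : ∀ N, ∑ k ∈ Finset.range N, ‖p.coeff k‖ ^ 2 ≤ B ^ 2 := by
    intro N
    have hcont : Continuous fun r : ℝ => ∑ k ∈ Finset.range N, (r ^ 2) ^ k * ‖p.coeff k‖ ^ 2 := by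
      fun_prop
    -- The bound on finitely many coefficients passes to the limit `r → 1`.
    have hlim := (hcont.tendsto 1).mono_left (nhdsWithin_le_nhds (s := Set.Iio 1))
    simp only [one_pow, one_mul] at hlim
    refine le_of_tendsto hlim ?_
    filter_upwards [self_mem_nhdsWithin, nhdsWithin_le_nhds (Ioi_mem_nhds one_half_lt_one)]
      with r hr1 hr0
    have hr0 : (1 / 2 : ℝ) < r := hr0
    exact (sum_norm_coeff_sq_le hF hp (by linarith) hr1 N).trans (hmean r (by linarith) hr1)
  have hsum : Summable fun k => ‖p.coeff k‖ ^ 2 :=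
    summable_of_sum_range_le (fun k => sq_nonneg _) hcoeff
  refine ⟨⟨fun k => p.coeff k, HardySpace.memlp_iff.2 hsum⟩, ?_, ?_⟩
  · intro z hz
    set g : HardySpace := ⟨fun k => p.coeff k, HardySpace.memlp_iff.2 hsum⟩ with hg
    have hev : g.eval =ᶠ[nhds 0] F := by
      have h1 := (hasFPowerSeriesAt_iff.1 hp)
      filter_upwards [h1] with w hw
      rw [zero_add] at hw
      rw [← hw.tsum_eq, HardySpace.eval]
      exact tsum_congr fun k => mul_comm _ _
    exact ((HardySpace.differentiableOn_eval g).analyticOnNhd isOpen_ball).eqOn_of_preconnected_of_eventuallyEq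
      (hF.analyticOnNhd isOpen_ball) (convex_ball (0 : ℂ) 1).isPreconnected
      (mem_ball_self one_pos) hev hz
  · refine (abs_le_of_sq_le_sq' ?_ hB).2
    rw [HardySpace.norm_sq_eq_tsum]
    exact hsum.tsum_le_of_sum_range_le hcoeff

namespace HardySpace

/-- A holomorphic function whose real part is a harmonic majorant of `|f|²`. -/
noncomputable def majorant (f : HardySpace) (z : ℂ) : ℂ :=
  inner ℂ f (resolvent z f + z • shift (resolvent z f))

theorem differentiableOn_majorant (f : HardySpace) :
    DifferentiableOn ℂ f.majorant (ball 0 1) := by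
  have h2 : DifferentiableOn ℂ (fun z => resolvent z f) (ball 0 1) :=
    differentiableOn_resolvent.clm_apply (differentiableOn_const f)
  have h3 : DifferentiableOn ℂ (fun z => shift (resolvent z f)) (ball 0 1) :=
    shift.differentiable.comp_differentiableOn h2
  exact (innerSL ℂ f).differentiable.comp_differentiableOn (h2.add (differentiableOn_id.smul h3))

/-- With `g = resolvent z f` and `u = z • shift g`, the majorant is `⟪g - u, g + u⟫`, whose cross
terms are purely imaginary. -/
theorem re_majorant (f : HardySpace) {z : ℂ} (hz : ‖z‖ < 1) :
    (f.majorant z).re = ‖resolvent z f‖ ^ 2 - ‖z‖ ^ 2 * ‖shift (resolvent z f)‖ ^ 2 := by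
  set g := resolvent z f with hg
  have hf : g - z • shift g = f := resolvent_sub f hz
  have h1 : f.majorant z = inner ℂ (g - z • shift g) (g + z • shift g) := by rw [hf]; rfl
  set u := z • shift g with hu
  have h2 : ‖u‖ ^ 2 = ‖z‖ ^ 2 * ‖shift g‖ ^ 2 := by rw [hu, norm_smul, mul_pow]
  rw [h1, ← h2, inner_sub_left, inner_add_right, inner_add_right, inner_self_eq_norm_sq_to_K,
    inner_self_eq_norm_sq_to_K, ← inner_conj_symm u g]
  simp only [sub_re, add_re, conj_re, coe_algebraMap, ← ofReal_pow, ofReal_re]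
  ring

theorem norm_eval_sq_le_re_majorant (f : HardySpace) {z : ℂ} (hz : ‖z‖ < 1) :
    ‖f.eval z‖ ^ 2 ≤ (f.majorant z).re := by
  rw [re_majorant f hz, eval_eq_resolvent_apply_zero f hz]
  have h := norm_sq_eq_add_shift (resolvent z f)
  have hz2 : ‖z‖ ^ 2 ≤ 1 := pow_le_one₀ (norm_nonneg z) hz.le
  nlinarith [mul_nonneg (sub_nonneg.2 hz2) (sq_nonneg ‖shift (resolvent z f)‖)]

theorem re_majorant_le (f : HardySpace) {z : ℂ} (hz : ‖z‖ < 1) :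
    (f.majorant z).re ≤ ((1 - ‖z‖)⁻¹ * ‖f‖) ^ 2 := by
  rw [re_majorant f hz]
  have h1 : ‖resolvent z f‖ ≤ (1 - ‖z‖)⁻¹ * ‖f‖ := by
    rw [inv_mul_eq_div, le_div_iff₀ (sub_pos.2 hz)]
    have h2 := norm_sub_norm_le (resolvent z f) (z • shift (resolvent z f))
    rw [resolvent_sub f hz, norm_smul] at h2
    have h3 := (shift.le_opNorm (resolvent z f)).trans
      (mul_le_of_le_one_left (norm_nonneg _) norm_shift_le)
    nlinarith [mul_le_mul_of_nonneg_left h3 (norm_nonneg z)]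
  have h4 := pow_le_pow_left₀ (norm_nonneg _) h1 2
  nlinarith [mul_nonneg (sq_nonneg ‖z‖) (sq_nonneg ‖shift (resolvent z f)‖)]

end HardySpace

/-- Littlewood's subordination principle. -/
theorem exists_isCompositionOperator {φ : ℂ → ℂ} (hφ : IsHolomorphicSelfMap φ) :
    ∃ T : HardySpace →L[ℂ] HardySpace, IsCompositionOperator φ T := by
  have hφ0 : ‖φ 0‖ < 1 := by simpa using hφ.2 (mem_ball_self one_pos)
  have hex : ∀ f : HardySpace, ∃ g : HardySpace, (∀ z ∈ ball (0 : ℂ) 1, g.eval z = f.eval (φ z)) ∧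
      ‖g‖ ≤ (1 - ‖φ 0‖)⁻¹ * ‖f‖ := by
    intro f
    have hF : DifferentiableOn ℂ (fun z => f.eval (φ z)) (ball 0 1) :=
      (HardySpace.differentiableOn_eval f).comp hφ.1 hφ.2
    have hH : DifferentiableOn ℂ (fun z => f.majorant (φ z)) (ball 0 1) :=
      (HardySpace.differentiableOn_majorant f).comp hφ.1 hφ.2
    have hpos := sub_pos.2 hφ0
    refine exists_hardySpace_of_circleAverage_le (by positivity) hF fun r hr0 hr1 => ?_
    calc _ ≤ Real.circleAverage (fun z => (f.majorant (φ z)).re) 0 r := by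
          refine Real.circleAverage_mono
            (circleIntegrable_of_continuousOn_ball (hF.continuousOn.norm.pow 2) hr0 hr1)
            (circleIntegrable_of_continuousOn_ball
              (continuous_re.comp_continuousOn hH.continuousOn) hr0 hr1) fun z hz => ?_
          rw [abs_of_nonneg hr0, mem_sphere_zero_iff_norm] at hz
          refine HardySpace.norm_eval_sq_le_re_majorant f ?_
          simpa using hφ.2 (show z ∈ ball (0 : ℂ) 1 by simpa [hz] using hr1)
      _ = (f.majorant (φ 0)).re := circleAverage_re_of_differentiableOn_ball hH hr0 hr1
      _ ≤ _ := HardySpace.re_majorant_le f hφ0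
  choose g hg hgn using hex
  have hφn : ∀ z ∈ ball (0 : ℂ) 1, ‖φ z‖ < 1 := fun z hz => by simpa using hφ.2 hz
  refine ⟨LinearMap.mkContinuous ⟨⟨g, fun f₁ f₂ => ?_⟩, fun c f => ?_⟩ (1 - ‖φ 0‖)⁻¹ hgn, hg⟩
  · refine HardySpace.ext_eval fun z hz => ?_
    rw [HardySpace.eval_add _ _ (by simpa using hz), hg _ z hz, hg _ z hz, hg _ z hz,
      HardySpace.eval_add _ _ (hφn z hz)]
  · refine HardySpace.ext_eval fun z hz => ?_
    rw [RingHom.id_apply, HardySpace.eval_smul _ _ (by simpa using hz), hg _ z hz, hg _ z hz,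
      HardySpace.eval_smul _ _ (hφn z hz)]

/-! ### Interpolation by a linear operator -/

namespace HardySpace

/-- If data on a finite set can be interpolated with norm control, the interpolation can be chosen
linear in the data. -/
theorem exists_linear_interpolation {ι : Type*} [Fintype ι] {e : ι → ℂ} (he : ∀ i, ‖e i‖ < 1)
    {B : (ι → ℂ) → ℝ} (h : ∀ b : ι → ℂ, ∃ f : HardySpace, (∀ i, f.eval (e i) = b i) ∧ ‖f‖ ≤ B b) :
    ∃ L : (ι → ℂ) →ₗ[ℂ] HardySpace, ∀ b, (∀ i, (L b).eval (e i) = b i) ∧ ‖L b‖ ≤ B b := by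
  classical
  choose f hf hfB using h
  set U : Submodule ℂ HardySpace := Submodule.span ℂ (Set.range fun i => kernel (e i) (he i))
    with hU
  have : FiniteDimensional ℂ U := FiniteDimensional.span_of_finite ℂ (Set.finite_range _)
  have hk : ∀ i, kernel (e i) (he i) ∈ U := fun i => Submodule.subset_span ⟨i, rfl⟩
  have heval : ∀ (g : HardySpace) i, (U.starProjection g).eval (e i) = g.eval (e i) := by
    intro g i
    rw [eval_eq_inner _ (he i), eval_eq_inner _ (he i), ← Submodule.inner_starProjection_left_eq_right,
      Submodule.starProjection_eq_self_iff.2 (hk i)]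
  set L : (ι → ℂ) →ₗ[ℂ] HardySpace :=
    ∑ i, (LinearMap.proj i : (ι → ℂ) →ₗ[ℂ] ℂ).smulRight (U.starProjection (f (Pi.single i 1)))
    with hL
  have hLapply : ∀ b, L b = ∑ i, b i • U.starProjection (f (Pi.single i 1)) := by
    intro b
    simp [hL]
  have hLeval : ∀ b i, (L b).eval (e i) = b i := by
    intro b i
    have h1 : (L b).eval (e i) = ∑ j, b j * (U.starProjection (f (Pi.single j 1))).eval (e i) := by
      simp only [eval_eq_inner _ (he i), hLapply, inner_sum, inner_smul_right]
    simp only [h1, heval, hf, Pi.single_apply, mul_ite, mul_one, mul_zero, Finset.sum_ite_eq,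
      Finset.mem_univ, if_true]
  have hLU : ∀ b, L b ∈ U := by
    intro b
    rw [hLapply]
    exact Submodule.sum_mem _ fun i _ => Submodule.smul_mem _ _ (Submodule.starProjection_apply_mem _ _)
  refine ⟨L, fun b => ⟨hLeval b, ?_⟩⟩
  -- Any interpolant of `b` differs from `L b` by a vector orthogonal to the kernels. Hence `L b` is
  -- its projection, and the norm bound is inherited.
  have hproj : U.starProjection (f b) = L b := by
    refine Submodule.eq_starProjection_of_mem_of_inner_eq_zero (hLU b) fun w hw => ?_
    rw [inner_eq_zero_symm]
    refine Submodule.span_induction ?_ (inner_zero_left _) (fun x y _ _ hx hy => ?_)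
      (fun c x _ hx => ?_) hw
    · rintro _ ⟨i, rfl⟩
      rw [inner_sub_right, ← eval_eq_inner, ← eval_eq_inner, hf, hLeval, sub_self]
    · rw [inner_add_left, hx, hy, add_zero]
    · rw [inner_smul_left, hx, mul_zero]
  rw [← hproj]
  exact (Submodule.norm_starProjection_apply_le _ _).trans (hfB b)

end HardySpace

theorem exists_ne_zero_of_rank_lt {H K : Type} [AddCommGroup H] [Module ℂ H] [AddCommGroup K]
    [Module ℂ K] {n : ℕ} (R : H →ₗ[ℂ] K) (hR : LinearMap.rank R < (n : Cardinal))
    (L : (Fin n → ℂ) →ₗ[ℂ] H) : ∃ c ≠ 0, R (L c) = 0 := by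
  by_contra! hcon
  have hinj : Function.Injective (R ∘ₗ L) := by
    rw [← LinearMap.ker_eq_bot, LinearMap.ker_eq_bot']
    intro c hc
    by_contra h0
    exact hcon c h0 hc
  have h1 : LinearMap.rank (R ∘ₗ L) = n := by
    rw [LinearMap.rank, rank_range_of_injective _ hinj, rank_fin_fun]
  exact absurd ((LinearMap.rank_comp_le_left L R).trans_lt hR) (by rw [h1]; exact lt_irrefl _)

theorem le_sInf_mul {s : Set ℝ} {x y : ℝ} (hs : s.Nonempty) (hy : 0 ≤ y)
    (h : ∀ C ∈ s, x ≤ C * y) : x ≤ sInf s * y := by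
  rcases hy.eq_or_lt with rfl | hy
  · obtain ⟨C, hC⟩ := hs
    simpa using h C hC
  · rw [← div_le_iff₀ hy]
    exact le_csInf hs fun C hC => (div_le_iff₀ hy).2 (h C hC)

/-- The real infimum of the empty set is `0`, so a nonzero constant has admissible competitors. -/
theorem nonempty_of_sInf_ne_zero {s : Set ℝ} (h : sInf s ≠ 0) : s.Nonempty := by
  rw [Set.nonempty_iff_ne_empty]
  rintro rfl
  exact h Real.sInf_empty

/-! ### The lower bound for approximation numbers. -/

section LowerBound

variable {n : ℕ} {z : Fin n → ℂ}

theorem lintegral_pointMeasure_le_iff (hz : ∀ i, ‖z i‖ < 1) (f : HardySpace) {B : ℝ} (hB : 0 ≤ B) :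
    ∫⁻ x, ENNReal.ofReal (‖f.eval x‖ ^ 2) ∂(pointMeasure z) ≤ ENNReal.ofReal B ↔
      ∑ i, (1 - ‖z i‖ ^ 2) * ‖f.eval (z i)‖ ^ 2 ≤ B := by
  have hd : ∀ i, 0 ≤ 1 - ‖z i‖ ^ 2 := fun i =>
    sub_nonneg.2 (pow_le_one₀ (norm_nonneg _) (hz i).le)
  rw [← ENNReal.ofReal_le_ofReal_iff hB,
    ENNReal.ofReal_sum_of_nonneg fun i _ => mul_nonneg (hd i) (sq_nonneg _)]
  simp [pointMeasure, MeasureTheory.lintegral_finsetSum_measure,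
    MeasureTheory.lintegral_smul_measure, MeasureTheory.lintegral_dirac, ENNReal.ofReal_mul (hd _)]

variable {φ ψ : ℂ → ℂ} {T R : HardySpace →L[ℂ] HardySpace} {N : ℝ}

/-- The lower estimate against a fixed operator of rank less than `n`, given interpolation with
constant `C` on the images of the points and a Carleson embedding with constant `N`. -/
theorem le_mul_norm_sub_of_interpolation {C I : ℝ} (hφ : ∀ i, ‖φ (z i)‖ < 1)
    (hψ : ∀ i, ‖ψ (z i)‖ < 1)
    (hT : ∀ f i, (T f).eval (z i) = HardySpace.eval f (φ (z i)) - HardySpace.eval f (ψ (z i)))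
    (hN0 : 0 ≤ N)
    (hN : ∀ f : HardySpace, ∑ i, (1 - ‖z i‖ ^ 2) * ‖f.eval (z i)‖ ^ 2 ≤ N * ‖f‖ ^ 2)
    (hC : ∀ b : Fin n ⊕ Fin n → ℂ, ∃ f : HardySpace,
      (∀ i, f.eval (Sum.elim (φ ∘ z) (ψ ∘ z) i) = b i) ∧
        ‖f‖ ≤ C * √(∑ i, ‖b i‖ ^ 2 * (1 - ‖Sum.elim (φ ∘ z) (ψ ∘ z) i‖ ^ 2)))
    (hI : ∀ i, I ≤ (1 - ‖z i‖ ^ 2) / (1 - ‖φ (z i)‖ ^ 2) + (1 - ‖z i‖ ^ 2) / (1 - ‖ψ (z i)‖ ^ 2))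
    (hR : LinearMap.rank (R : HardySpace →ₗ[ℂ] HardySpace) < (n : Cardinal)) :
    I ≤ C ^ 2 * (N * ‖T - R‖ ^ 2) := by
  obtain ⟨L, hL⟩ := HardySpace.exists_linear_interpolation
    (e := Sum.elim (φ ∘ z) (ψ ∘ z)) (by rintro (i | i); exacts [hφ i, hψ i]) hC
  set p : Fin n → ℝ := fun i => 1 - ‖φ (z i)‖ ^ 2 with hp
  set q : Fin n → ℝ := fun i => 1 - ‖ψ (z i)‖ ^ 2 with hq
  have hp0 : ∀ i, 0 < p i := fun i => sub_pos.2 (pow_lt_one₀ (norm_nonneg _) (hφ i) two_ne_zero)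
  have hq0 : ∀ i, 0 < q i := fun i => sub_pos.2 (pow_lt_one₀ (norm_nonneg _) (hψ i) two_ne_zero)
  -- For a prescribed difference of the two values, the weights `1/p` and `-1/q` minimise the cost
  -- `|a|² p + |b|² q`. They produce the sum of the two quotients in the bound.
  let S : (Fin n → ℂ) →ₗ[ℂ] (Fin n ⊕ Fin n → ℂ) := LinearMap.pi (Sum.elim
    (fun i => ((p i)⁻¹ : ℂ) • LinearMap.proj i) (fun i => (-(q i)⁻¹ : ℂ) • LinearMap.proj i))
  have hSl : ∀ c i, S c (Sum.inl i) = (p i : ℂ)⁻¹ * c i := fun c i => by simp [S]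
  have hSr : ∀ c i, S c (Sum.inr i) = -(q i : ℂ)⁻¹ * c i := fun c i => by simp [S]
  obtain ⟨c, hc0, hc⟩ := exists_ne_zero_of_rank_lt (R : HardySpace →ₗ[ℂ] HardySpace) hR (L ∘ₗ S)
  set f := L (S c) with hf
  have hRf : R f = 0 := hc
  set A := ∑ i, ‖c i‖ ^ 2 * ((p i)⁻¹ + (q i)⁻¹) with hA
  have hκ : ∀ i, 0 < (p i)⁻¹ + (q i)⁻¹ := fun i => add_pos (inv_pos.2 (hp0 i)) (inv_pos.2 (hq0 i))
  have hA0 : 0 < A := by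
    obtain ⟨i, hi⟩ := Function.ne_iff.1 hc0
    refine Finset.sum_pos' (fun j _ => mul_nonneg (sq_nonneg _) (hκ j).le) ⟨i, Finset.mem_univ i, ?_⟩
    exact mul_pos (pow_pos (norm_pos_iff.2 hi) 2) (hκ i)
  have hdata : ∑ i, ‖S c i‖ ^ 2 * (1 - ‖Sum.elim (φ ∘ z) (ψ ∘ z) i‖ ^ 2) = A := by
    rw [Fintype.sum_sum_type, ← Finset.sum_add_distrib]
    refine Finset.sum_congr rfl fun i _ => ?_
    rw [hSl, hSr]
    simp only [Sum.elim_inl, Sum.elim_inr, Function.comp_apply, norm_mul, norm_neg, norm_inv,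
      norm_real, Real.norm_of_nonneg (hp0 i).le, Real.norm_of_nonneg (hq0 i).le]
    change ((p i)⁻¹ * ‖c i‖) ^ 2 * p i + ((q i)⁻¹ * ‖c i‖) ^ 2 * q i = _
    have := (hp0 i).ne'
    have := (hq0 i).ne'
    field_simp
  have hfn : ‖f‖ ^ 2 ≤ C ^ 2 * A := by
    have := (hL (S c)).2
    rw [hdata] at this
    have h2 := pow_le_pow_left₀ (norm_nonneg f) this 2
    rwa [mul_pow, Real.sq_sqrt hA0.le] at h2
  have hval : ∀ i, ‖((T - R) f).eval (z i)‖ ^ 2 = ‖c i‖ ^ 2 * ((p i)⁻¹ + (q i)⁻¹) ^ 2 := by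
    intro i
    have h1 := (hL (S c)).1 (Sum.inl i)
    have h2 := (hL (S c)).1 (Sum.inr i)
    simp only [Sum.elim_inl, Sum.elim_inr, Function.comp_apply, ← hf, hSl, hSr] at h1 h2
    have h3 : ((T - R) f).eval (z i) = (((p i)⁻¹ + (q i)⁻¹ : ℝ) : ℂ) * c i := by
      rw [sub_apply, hRf, sub_zero, hT, h1, h2]
      push_cast
      ring
    rw [h3, norm_mul, norm_real, Real.norm_of_nonneg (hκ i).le, mul_pow, mul_comm]
  have hlow : I * A ≤ ∑ i, (1 - ‖z i‖ ^ 2) * ‖((T - R) f).eval (z i)‖ ^ 2 := by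
    rw [hA, Finset.mul_sum]
    refine Finset.sum_le_sum fun i _ => ?_
    rw [hval]
    have h := mul_le_mul_of_nonneg_right (hI i)
      (mul_nonneg (sq_nonneg ‖c i‖) (hκ i).le)
    refine h.trans (le_of_eq ?_)
    change ((1 - ‖z i‖ ^ 2) / p i + (1 - ‖z i‖ ^ 2) / q i) * _ = _
    ring
  have hup : N * ‖(T - R) f‖ ^ 2 ≤ N * (‖T - R‖ ^ 2 * (C ^ 2 * A)) := by
    refine mul_le_mul_of_nonneg_left ?_ hN0
    have := pow_le_pow_left₀ (norm_nonneg _) ((T - R).le_opNorm f) 2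
    rw [mul_pow] at this
    exact this.trans (mul_le_mul_of_nonneg_left hfn (sq_nonneg _))
  refine le_of_mul_le_mul_right ?_ hA0
  calc I * A ≤ _ := hlow
    _ ≤ _ := hN _
    _ ≤ _ := hup
    _ = _ := by ring

theorem injective_sumElim_of_ncard {W : Set ℂ}
    (hW : W = φ '' Set.range z ∪ ψ '' Set.range z) (hcard : W.ncard = 2 * n) :
    Function.Injective (Sum.elim (φ ∘ z) (ψ ∘ z)) ∧ Set.range (Sum.elim (φ ∘ z) (ψ ∘ z)) = W := by
  classical
  have hrange : Set.range (Sum.elim (φ ∘ z) (ψ ∘ z)) = W := by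
    rw [Set.Sum.elim_range, Set.range_comp, Set.range_comp, hW]
  refine ⟨?_, hrange⟩
  have h1 : (Finset.univ.image (Sum.elim (φ ∘ z) (ψ ∘ z))).card =
      (Finset.univ : Finset (Fin n ⊕ Fin n)).card := by
    rw [← Set.ncard_coe_finset, Finset.coe_image, Finset.coe_univ, Set.image_univ, hrange, hcard]
    simp [two_mul]
  have h2 := Finset.card_image_iff.1 h1
  rwa [Finset.coe_univ, Set.injOn_univ] at h2

theorem lower_bound_approximationNumber {W : Set ℂ} (hz : ∀ i, z i ∈ ball (0 : ℂ) 1)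
    (hφ : IsHolomorphicSelfMap φ) (hψ : IsHolomorphicSelfMap ψ) (hn : 1 ≤ n)
    (hW : W = φ '' Set.range z ∪ ψ '' Set.range z) (hcard : W.ncard = 2 * n)
    {Cφ Cψ : HardySpace →L[ℂ] HardySpace} (hCφ : IsCompositionOperator φ Cφ)
    (hCψ : IsCompositionOperator ψ Cψ) (hN0 : 0 < N)
    (hN : ∀ f : HardySpace, ∑ i, (1 - ‖z i‖ ^ 2) * ‖f.eval (z i)‖ ^ 2 ≤ N * ‖f‖ ^ 2) :
    (interpolationConstant W)⁻¹ * N ^ (-(1 / 2) : ℝ) *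
      (⨅ j, ((1 - ‖z j‖ ^ 2) / (1 - ‖φ (z j)‖ ^ 2) +
        (1 - ‖z j‖ ^ 2) / (1 - ‖ψ (z j)‖ ^ 2))) ^ (1 / 2 : ℝ)
      ≤ approximationNumber n (Cφ - Cψ) := by
  set I := ⨅ j, ((1 - ‖z j‖ ^ 2) / (1 - ‖φ (z j)‖ ^ 2) +
    (1 - ‖z j‖ ^ 2) / (1 - ‖ψ (z j)‖ ^ 2)) with hI
  have hIle : ∀ i, I ≤ (1 - ‖z i‖ ^ 2) / (1 - ‖φ (z i)‖ ^ 2) +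
      (1 - ‖z i‖ ^ 2) / (1 - ‖ψ (z i)‖ ^ 2) := fun i => ciInf_le (Set.finite_range _).bddBelow i
  have hz' : ∀ i, ‖z i‖ < 1 := fun i => by simpa using hz i
  have hφz : ∀ i, ‖φ (z i)‖ < 1 := fun i => by simpa using hφ.2 (hz i)
  have hψz : ∀ i, ‖ψ (z i)‖ < 1 := fun i => by simpa using hψ.2 (hz i)
  obtain ⟨hinj, hrange⟩ := injective_sumElim_of_ncard hW hcard
  refine le_csInf ⟨_, 0, ?_, rfl⟩ ?_
  · rw [ContinuousLinearMap.toLinearMap_zero, LinearMap.rank_zero]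
    exact_mod_cast hn
  rintro _ ⟨R, hR, rfl⟩
  set M := interpolationConstant W with hM
  have hM0 : 0 ≤ M := Real.sInf_nonneg fun C hC => hC.1
  -- If the constant is `0`, its inverse is `0` by convention and the bound is trivial.
  rcases hM0.eq_or_lt with hM0 | hM0
  · rw [← hM0]
    simp
  have key : √I ≤ M * (√N * ‖Cφ - Cψ - R‖) := by
    refine le_sInf_mul (nonempty_of_sInf_ne_zero hM0.ne') (by positivity) ?_
    rintro C ⟨hC0, hC⟩
    have h := le_mul_norm_sub_of_interpolation (T := Cφ - Cψ) (R := R) (C := C) (I := I) hφz hψz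
      (fun f i => by
        rw [sub_apply, HardySpace.eval_sub _ _ (hz' i), hCφ f _ (hz i),
          hCψ f _ (hz i)]) hN0.le hN ?_ hIle hR
    · calc √I ≤ √((C * (√N * ‖Cφ - Cψ - R‖)) ^ 2) := by
            refine Real.sqrt_le_sqrt (h.trans (le_of_eq ?_))
            rw [mul_pow, mul_pow, Real.sq_sqrt hN0.le]
        _ = _ := Real.sqrt_sq (by positivity)
    · subst hrange
      intro b
      let E := Equiv.ofInjective _ hinj
      have : Finite (Set.range (Sum.elim (φ ∘ z) (ψ ∘ z))) := Set.finite_range _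
      obtain ⟨f, hf, hfn⟩ := hC (fun w => b (E.symm w)) Summable.of_finite
      refine ⟨f, fun i => ?_, ?_⟩
      · have := hf (E i)
        rwa [E.symm_apply_apply] at this
      · rw [← E.tsum_eq] at hfn
        simpa [tsum_fintype, E] using hfn
  have hN2 : N ^ (-(1 / 2) : ℝ) = (√N)⁻¹ := by
    rw [Real.rpow_neg hN0.le, Real.sqrt_eq_rpow]
  rw [hN2, ← Real.sqrt_eq_rpow, mul_assoc, inv_mul_le_iff₀ hM0,
    inv_mul_le_iff₀ (Real.sqrt_pos.2 hN0)]
  linarith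

end LowerBound

theorem approximationNumber_nonneg {H K : Type*} [NormedAddCommGroup H] [InnerProductSpace ℂ H]
    [NormedAddCommGroup K] [InnerProductSpace ℂ K] (n : ℕ) (T : H →L[ℂ] K) :
    0 ≤ approximationNumber n T := by
  refine Real.sInf_nonneg ?_
  rintro _ ⟨R, -, rfl⟩
  exact norm_nonneg _

theorem mainTheorem6 :
    ∃ c : ℝ, 0 < c ∧
      ∀ φ ψ : ℂ → ℂ, IsHolomorphicSelfMap φ → IsHolomorphicSelfMap ψ →
      ∀ n : ℕ, 1 ≤ n →
      ∀ z : Fin n → ℂ, Function.Injective z → (∀ j, z j ∈ Metric.ball (0 : ℂ) 1) →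
      ∀ W : Set ℂ, W = φ '' Set.range z ∪ ψ '' Set.range z → W.ncard = 2 * n →
      ∃ Cφ Cψ : HardySpace →L[ℂ] HardySpace,
        IsCompositionOperator φ Cφ ∧ IsCompositionOperator ψ Cψ ∧
        (interpolationConstant W)⁻¹ * (carlesonNorm (pointMeasure z)) ^ (-(1 / 2) : ℝ) *
            (⨅ j, ((1 - ‖z j‖ ^ 2) / (1 - ‖φ (z j)‖ ^ 2) +
              (1 - ‖z j‖ ^ 2) / (1 - ‖ψ (z j)‖ ^ 2))) ^ (1 / 2 : ℝ)
          ≤ approximationNumber n (Cφ - Cψ) ∧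
        c * ((interpolationConstant W)⁻¹ *
            (geometricCarlesonNorm (pointMeasure z)) ^ (-(1 / 2) : ℝ) *
            (⨅ j, ((1 - ‖z j‖ ^ 2) / (1 - ‖φ (z j)‖ ^ 2) +
              (1 - ‖z j‖ ^ 2) / (1 - ‖ψ (z j)‖ ^ 2))) ^ (1 / 2 : ℝ))
          ≤ approximationNumber n (Cφ - Cψ) := by
  -- `1024 = 8 · 128`: the factor of the kernel test times that of the dyadic estimate.
  refine ⟨(1024 : ℝ) ^ (-(1 / 2) : ℝ), by positivity, ?_⟩
  intro φ ψ hφ hψ n hn z _ hz W hW hcard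
  have hz' : ∀ i, ‖z i‖ < 1 := fun i => by simpa using hz i
  obtain ⟨Cφ, hCφ⟩ := exists_isCompositionOperator hφ
  obtain ⟨Cψ, hCψ⟩ := exists_isCompositionOperator hψ
  have hzero : (0 : ℝ) ^ (-(1 / 2) : ℝ) = 0 := Real.zero_rpow (by norm_num)
  refine ⟨Cφ, Cψ, hCφ, hCψ, ?_, ?_⟩
  · have h0 : 0 ≤ carlesonNorm (pointMeasure z) := Real.sInf_nonneg fun C hC => hC.1
    -- A vanishing norm makes the left side `0`, because `0 ^ (-1/2) = 0` by convention. The same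
    -- split serves the geometric norm.
    rcases h0.eq_or_lt with h0 | h0
    · rw [← h0, hzero, mul_zero, zero_mul]
      exact approximationNumber_nonneg _ _
    · refine lower_bound_approximationNumber hz hφ hψ hn hW hcard hCφ hCψ h0 fun f => ?_
      refine le_sInf_mul (nonempty_of_sInf_ne_zero h0.ne') (sq_nonneg _) ?_
      rintro C ⟨hC0, hC⟩
      exact (lintegral_pointMeasure_le_iff hz' f (by positivity)).1 (hC f)
  · have h0 : 0 ≤ geometricCarlesonNorm (pointMeasure z) := Real.sInf_nonneg fun C hC => hC.1
    rcases h0.eq_or_lt with h0 | h0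
    · rw [← h0, hzero, mul_zero, zero_mul, mul_zero]
      exact approximationNumber_nonneg _ _
    · refine le_trans (le_of_eq ?_) (lower_bound_approximationNumber
        (N := 1024 * geometricCarlesonNorm (pointMeasure z)) hz hφ hψ hn hW hcard hCφ hCψ
        (by positivity) fun f => ?_)
      · rw [Real.mul_rpow (by norm_num) h0.le]
        ring
      · rw [mul_comm (1024 : ℝ), mul_assoc]
        refine le_sInf_mul (nonempty_of_sInf_ne_zero h0.ne') (by positivity) ?_
        rintro C ⟨hC0, hC⟩
        refine (sum_norm_eval_sq_le_of_geometric hz' hC0 hC f).trans (le_of_eq ?_)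
        ring
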